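/- For a finite set $P$ of points in the Euclidean plane, let the Gabriel graph $0\text{-}GG(P)$ be the graph with vertex set $P$ in which two distinct points $p,q\in P$ are adjacent if and only if the closed disk having the segment $pq$ as a diameter contains no point of $P\setminus\{p,q\}$. A matching in a graph is a set of edges no two of which share a vertex; its size is its number of edges. (i) For every set $P$ of $n$ points in the plane, $0\text{-}GG(P)$ has a matching of size at least $\frac{n-1}{4}$. (ii) This bound is tight: there is a set $P$ of $n=17$ points in the plane such that $0\text{-}GG(P)$ is a tree of maximum degree four and the maximum size of a matching in $0\text{-}GG(P)$ is exactly $\frac{n-1}{4}=4$. -/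

import Mathlib

/-- The Euclidean plane. -/
abbrev Plane : Type := EuclideanSpace ℝ (Fin 2)

/-- The closed disk which has the line segment `pq` as a diameter. -/
def diametralDisk (p q : Plane) : Set Plane :=
  Metric.closedBall (midpoint ℝ p q) (dist p q / 2)

/-- The order-`k` Gabriel graph (`k`-GG) on the finite point set `P`: its vertices are the points
of `P`, and two distinct points `p`, `q` of `P` are adjacent if and only if the closed disk with
diameter `pq` contains at most `k` points of `P \ {p, q}`. -/
def gabrielGraph (k : ℕ) (P : Finset Plane) : SimpleGraph P where
  Adj p q := p ≠ q ∧
    (((P : Set Plane) \ {(p : Plane), (q : Plane)}) ∩ diametralDisk p q).ncard ≤ k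
  symm := ⟨by
    rintro p q ⟨hne, h⟩
    refine ⟨hne.symm, ?_⟩
    rwa [diametralDisk, midpoint_comm, dist_comm, Set.pair_comm]⟩
  loopless := ⟨fun _ h => h.1 rfl⟩

noncomputable instance (k : ℕ) (P : Finset Plane) : DecidableRel (gabrielGraph k P).Adj :=
  Classical.decRel _

/-- The set of all sizes (numbers of edges) of matchings in a graph `G`. -/
def matchingSizes {V : Type*} (G : SimpleGraph V) : Set ℕ :=
  {m | ∃ M : G.Subgraph, M.IsMatching ∧ M.edgeSet.ncard = m}

/-!
The lower bound rests on Tutte's theorem, in the form with a deficiency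
(`SimpleGraph.exists_isMatching_of_oddComponents_le`): it suffices to show that the removal of any
set `S` of `s` points from the Gabriel graph of `n` points leaves at most `1 + 3 * s` components,
since it also leaves at most `n - s` components
(`SimpleGraph.exists_isMatching_of_card_connectedComponent_le`).

For this bound (`card_connectedComponent_le_one_add_three_mul`), let `T` be a Euclidean minimum
spanning tree of the remaining points. The disk of an edge of `T` contains no third vertex of `T`,
so the edge is missing from the Gabriel graph only if its disk contains a point of `S`; and the
removal of `k` edges from `T` leaves `k + 1` components. Hence it is enough that each point `p` of
`S` lies in the disks of at most three edges of `T`. Remove these edges, and let `x C` be the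
point nearest to `p` in each component `C` that is left, and `C₀` the component nearest to `p`. All
edges `ab` which are removed satisfy `|pa|² + |pb|² ≤ |ab|²`, and no edge on the path from `x C` to
`x D` in `T` is longer than the distance of `x C` and `x D`. So the points `x D` with `D ≠ C₀` lie
in the half-plane opposite to `x C₀`, and `p` sees any two of them under an angle greater than
`π / 3`. Therefore there are at most three of them, and at most four components
(`card_connectedComponent_le_four`).

The bound is attained by a comb: the points `(k, 0)` for `-1 ≤ k ≤ 7`, and `(k, 1)`, `(k, -1)` for
`k = 0, 2, 4, 6`. Its Gabriel graph is a tree in which the four vertices `(k, 0)` with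
`k = 0, 2, 4, 6` have degree four and cover all the edges. Neighbours of these vertices in
perpendicular directions are not adjacent because the disks are closed.
-/

/-! ### Spanning trees -/

namespace SimpleGraph

variable {V W : Type*}

/-- Deleting edges of a connected graph creates at most one new component per deleted edge. The
components of `F` are the vertices of a connected quotient graph, and each edge of the quotient
comes from a deleted edge. -/
theorem Connected.card_connectedComponent_le [Finite V] {T F : SimpleGraph V} (hT : T.Connected) :
    Nat.card F.ConnectedComponent ≤ (T.edgeSet \ F.edgeSet).ncard + 1 := by
  let Q : SimpleGraph F.ConnectedComponent := T.map F.connectedComponentMk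
  have hQ : Q.Connected := by
    have := hT.nonempty
    refine ⟨fun C D => ?_⟩
    induction C using ConnectedComponent.ind with | _ a
    induction D using ConnectedComponent.ind with | _ b
    have hab := hT a b
    rw [reachable_iff_reflTransGen] at hab
    induction hab with
    | refl => exact .rfl
    | @tail x y _ hxy ih =>
      refine ih.trans ?_
      by_cases h : F.connectedComponentMk x = F.connectedComponentMk y
      · rw [h]
      · exact Adj.reachable (map_adj_apply' hxy h)
  refine hQ.card_vert_le_card_edgeSet_add_one.trans (Nat.add_le_add_right ?_ 1)
  rw [Nat.card_coe_set_eq]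
  have hsub : Q.edgeSet ⊆ Sym2.map F.connectedComponentMk '' (T.edgeSet \ F.edgeSet) := by
    intro e he
    induction e with | _ C D
    obtain ⟨hne, x, y, hxy, rfl, rfl⟩ := (map_adj' _ _ _ _).1 ((mem_edgeSet Q).1 he)
    exact ⟨s(x, y), ⟨hxy, fun h => hne (ConnectedComponent.sound (Adj.reachable h))⟩, rfl⟩
  exact (Set.ncard_le_ncard hsub (Set.toFinite _)).trans (Set.ncard_image_le (Set.toFinite _))

/-- Deleting edges of a tree creates at least one new component per deleted edge: reconnecting the
components by a star has to restore the number of edges of a spanning tree. -/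
theorem IsTree.ncard_edgeSet_sdiff_add_one_le [Finite V] {T F : SimpleGraph V} (hT : T.IsTree)
    (hF : F ≤ T) :
    (T.edgeSet \ F.edgeSet).ncard + 1 ≤ Nat.card F.ConnectedComponent := by
  classical
  obtain ⟨v₀⟩ := hT.connected.nonempty
  let C₀ := F.connectedComponentMk v₀
  have hout : ∀ v, F.Reachable v (F.connectedComponentMk v).out := fun v =>
    ConnectedComponent.exact (Quot.out_eq _).symm
  let A : Set (Sym2 V) := (fun C : F.ConnectedComponent => s(C₀.out, C.out)) '' {C | C ≠ C₀}
  let G := F ⊔ fromEdgeSet A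
  have hG : G.Connected := by
    have key : ∀ v, G.Reachable v C₀.out := by
      intro v
      refine ((hout v).mono le_sup_left).trans ?_
      by_cases h : F.connectedComponentMk v = C₀
      · rw [h]
      · by_cases h' : (F.connectedComponentMk v).out = C₀.out
        · rw [h']
        · refine Adj.reachable (Or.inr ?_)
          rw [fromEdgeSet_adj]
          exact ⟨⟨_, h, Sym2.eq_swap⟩, h'⟩
    have : Nonempty V := ⟨v₀⟩
    exact ⟨fun a b => (key a).trans (key b).symm⟩
  have h1 := hG.card_vert_le_card_edgeSet_add_one
  have h2 := (isTree_iff_connected_and_card.1 hT).2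
  rw [Nat.card_coe_set_eq] at h1 h2
  have h3 : G.edgeSet.ncard ≤ F.edgeSet.ncard + A.ncard := by
    refine (Set.ncard_le_ncard ?_ (Set.toFinite _)).trans (Set.ncard_union_le _ _)
    rw [edgeSet_sup, edgeSet_fromEdgeSet]
    exact Set.union_subset_union_right _ Set.sdiff_subset
  have h4 : A.ncard + 1 ≤ Nat.card F.ConnectedComponent := by
    have : A.ncard ≤ ({C₀}ᶜ : Set F.ConnectedComponent).ncard := Set.ncard_image_le (Set.toFinite _)
    have := Set.ncard_add_ncard_compl ({C₀} : Set F.ConnectedComponent)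
    rw [Set.ncard_singleton] at this
    lia
  have h5 := Set.ncard_sdiff_add_ncard_of_subset (edgeSet_mono hF) (Set.toFinite _)
  lia

/-- Replacing an edge on the path between two vertices of a tree by an edge between these two
vertices gives a tree again. -/
theorem IsTree.deleteEdges_sup_edge [Finite V] {T : SimpleGraph V} (hT : T.IsTree) {x y : V}
    {p : T.Walk x y} (hp : p.IsPath) {e : Sym2 V} (he : e ∈ p.edges) :
    ¬ (T.deleteEdges {e}).Reachable x y ∧ (T.deleteEdges {e} ⊔ edge x y).IsTree := by
  classical
  have hxy : ¬ (T.deleteEdges {e}).Reachable x y := by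
    induction e with | _ a b
    rw [reachable_deleteEdges_iff_exists_walk]
    rintro ⟨q, hq⟩
    have h1 := (hT.isAcyclic.subsingleton_path x y).elim ⟨p, hp⟩ q.toPath
    have h2 : p = q.bypass := congrArg Subtype.val h1
    exact hq (q.edges_bypass_subset_edges (h2 ▸ he))
  have hne : x ≠ y := by rintro rfl; exact hxy .rfl
  have : Nonempty V := ⟨x⟩
  refine ⟨hxy, ⟨?_⟩, (hT.isAcyclic.anti (deleteEdges_le _)).sup_edge_of_not_reachable hxy⟩
  · set F := T.deleteEdges {e}
    have hle : F ≤ F ⊔ edge x y := le_sup_left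
    have hcard : Nat.card F.ConnectedComponent ≤ 2 := by
      refine (hT.connected.card_connectedComponent_le (F := F)).trans (Nat.add_le_add_right ?_ 1)
      refine (Set.ncard_le_ncard (t := {e}) ?_ (Set.toFinite _)).trans (Set.ncard_singleton e).le
      intro f hf
      by_contra hfe
      exact hf.2 (by rw [edgeSet_deleteEdges]; exact ⟨hf.1, hfe⟩)
    have hyx : (F ⊔ edge x y).Reachable y x :=
      Adj.reachable (Or.inr ((edge_adj ..).2 ⟨Or.inr ⟨rfl, rfl⟩, hne.symm⟩))
    have key : ∀ v, (F ⊔ edge x y).Reachable v x := by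
      intro v
      by_contra hv
      -- `x`, `y` and `v` would lie in three different components of `F`.
      have hvx : ¬ F.Reachable v x := fun h => hv (h.mono hle)
      have hvy : ¬ F.Reachable v y := fun h => hv ((h.mono hle).trans hyx)
      have h3 : ({F.connectedComponentMk v, F.connectedComponentMk x, F.connectedComponentMk y} :
          Set F.ConnectedComponent).ncard = 3 :=
        Set.ncard_eq_three.2 ⟨_, _, _, fun h => hvx (ConnectedComponent.exact h),
          fun h => hvy (ConnectedComponent.exact h), fun h => hxy (ConnectedComponent.exact h), rfl⟩
      have := Set.ncard_le_card (α := F.ConnectedComponent)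
        {F.connectedComponentMk v, F.connectedComponentMk x, F.connectedComponentMk y}
      lia
    exact fun a b => (key a).trans (key b).symm

/-- A spanning tree of minimum total weight is a bottleneck tree: no edge on the path between two
vertices is heavier than the edge which joins them directly. -/
theorem exists_isTree_forall_weight_le [Finite V] [Nonempty V] (w : Sym2 V → ℝ) :
    ∃ T : SimpleGraph V, T.IsTree ∧ ∀ (x y : V) (p : T.Walk x y), p.IsPath →
      ∀ e ∈ p.edges, w e ≤ w s(x, y) := by
  classical
  have hfin : ∀ T : SimpleGraph V, T.edgeSet.Finite := fun T => Set.toFinite _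
  obtain ⟨T₀, -, hT₀⟩ := (connected_top (V := V)).exists_isTree_le
  obtain ⟨T, hT, hmin⟩ := Set.exists_min_image {T : SimpleGraph V | T.IsTree}
    (fun T => ∑ e ∈ (hfin T).toFinset, w e) (Set.toFinite _) ⟨T₀, hT₀⟩
  refine ⟨T, hT, fun x y p hp e he => ?_⟩
  obtain ⟨hxy, hT'⟩ := IsTree.deleteEdges_sup_edge hT hp he
  have hne : x ≠ y := by rintro rfl; exact hxy .rfl
  have heq : (hfin (T.deleteEdges {e} ⊔ edge x y)).toFinset =
      insert s(x, y) ((hfin T).toFinset.erase e) := by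
    ext d
    simp only [Set.Finite.mem_toFinset, edgeSet_sup, edgeSet_deleteEdges, edgeSet_edge_of_ne hne,
      Finset.mem_insert, Finset.mem_erase, Set.mem_union, Set.mem_sdiff, Set.mem_singleton_iff]
    tauto
  have hnot : s(x, y) ∉ (hfin T).toFinset.erase e := by
    simp only [Set.Finite.mem_toFinset, Finset.mem_erase, not_and]
    intro h h'
    exact hxy (Adj.reachable (by simpa [deleteEdges_adj, h] using h'))
  have h := hmin _ hT'
  simp only [heq, Finset.sum_insert hnot] at h
  have := Finset.add_sum_erase _ w ((hfin T).mem_toFinset.2 (p.edges_subset_edgeSet he))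
  linarith

end SimpleGraph

/-! ### Disks of the edges of a minimum spanning tree -/

theorem Plane.dist_sq_eq (p q : Plane) : dist p q ^ 2 = (p 0 - q 0) ^ 2 + (p 1 - q 1) ^ 2 := by
  rw [EuclideanSpace.dist_sq_eq, Fin.sum_univ_two, Real.dist_eq, Real.dist_eq, sq_abs, sq_abs]

/-- Thales: the points of the disk with diameter `pq` see the segment `pq` under an angle of at
least `π / 2`. -/
theorem mem_diametralDisk_iff {p q r : Plane} :
    r ∈ diametralDisk p q ↔ dist p r ^ 2 + dist q r ^ 2 ≤ dist p q ^ 2 := by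
  have h0 : midpoint ℝ p q 0 = (p 0 + q 0) / 2 := by
    simp [midpoint_eq_smul_add]; ring
  have h1 : midpoint ℝ p q 1 = (p 1 + q 1) / 2 := by
    simp [midpoint_eq_smul_add]; ring
  have h2 : dist p q ^ 2 = _ := Plane.dist_sq_eq p q
  rw [diametralDisk, Metric.mem_closedBall,
    ← pow_le_pow_iff_left₀ dist_nonneg (by positivity) two_ne_zero, div_pow, h2]
  simp only [Plane.dist_sq_eq, h0, h1]
  constructor <;> intro h <;> linarith

/-- Two vectors `(U, V)` in one of three sectors of angle `π / 3` of the half-plane `0 ≤ U`, with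
`3 * U ^ 2 + V ^ 2` as the squared length, are at a distance at most the length of one of them. -/
theorem sq_sub_le_max_of_same_sector {U V U' V' : ℝ} (hU : 0 ≤ U) (hU' : 0 ≤ U')
    (h : U ≤ V ∧ U' ≤ V' ∨ V ≤ -U ∧ V' ≤ -U' ∨ (-U ≤ V ∧ V ≤ U) ∧ (-U' ≤ V' ∧ V' ≤ U')) :
    3 * (U - U') ^ 2 + (V - V') ^ 2 ≤ max (3 * U ^ 2 + V ^ 2) (3 * U' ^ 2 + V' ^ 2) := by
  -- In the basis of unit vectors along the two rays bounding the sector.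
  have key : ∀ s t s' t' : ℝ, 0 ≤ s → 0 ≤ t → 0 ≤ s' → 0 ≤ t' →
      (s - s') ^ 2 + (t - t') ^ 2 + (s - s') * (t - t') ≤
        max (s ^ 2 + t ^ 2 + s * t) (s' ^ 2 + t' ^ 2 + s' * t') := by
    intro s t s' t' hs ht hs' ht'
    rw [le_max_iff]
    rcases le_total s s' with h1 | h1 <;> rcases le_total t t' with h2 | h2
    · right; nlinarith [mul_nonneg hs hs', mul_nonneg ht ht', mul_nonneg hs ht, mul_nonneg hs ht',
        mul_nonneg hs' ht, mul_nonneg hs' ht', mul_nonneg hs (sub_nonneg.2 h1),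
        mul_nonneg ht (sub_nonneg.2 h2)]
    · rcases le_total (s' - s) (t - t') with h3 | h3
      · left; nlinarith [mul_nonneg (sub_nonneg.2 h1) (sub_nonneg.2 h3), mul_nonneg hs ht,
          mul_nonneg ht' (sub_nonneg.2 h2), mul_nonneg ht' ht]
      · right; nlinarith [mul_nonneg (sub_nonneg.2 h2) (sub_nonneg.2 h3), mul_nonneg hs' ht',
          mul_nonneg hs (sub_nonneg.2 h1), mul_nonneg hs' hs]
    · rcases le_total (s - s') (t' - t) with h3 | h3
      · right; nlinarith [mul_nonneg (sub_nonneg.2 h1) (sub_nonneg.2 h3), mul_nonneg hs' ht',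
          mul_nonneg ht (sub_nonneg.2 h2), mul_nonneg ht' ht]
      · left; nlinarith [mul_nonneg (sub_nonneg.2 h2) (sub_nonneg.2 h3), mul_nonneg hs ht,
          mul_nonneg hs' (sub_nonneg.2 h1), mul_nonneg hs' hs]
    · left; nlinarith [mul_nonneg hs hs', mul_nonneg ht ht', mul_nonneg hs ht, mul_nonneg hs ht',
        mul_nonneg hs' ht, mul_nonneg hs' ht', mul_nonneg hs' (sub_nonneg.2 h1),
        mul_nonneg ht' (sub_nonneg.2 h2)]
  rcases h with ⟨h1, h2⟩ | ⟨h1, h2⟩ | ⟨⟨h1, h2⟩, h3, h4⟩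
  · convert key (V - U) (2 * U) (V' - U') (2 * U') (by linarith) (by linarith) (by linarith)
      (by linarith) using 1 <;> ring_nf
  · convert key (-V - U) (2 * U) (-V' - U') (2 * U') (by linarith) (by linarith) (by linarith)
      (by linarith) using 1 <;> ring_nf
  · convert key (U + V) (U - V) (U' + V') (U' - V') (by linarith) (by linarith) (by linarith)
      (by linarith) using 1 <;> ring_nf

/-- The half-plane of the points which see `x` from `p` under an angle of at least `π / 2` is cut
into three sectors with apex `p` and angle `π / 3`. Two points of the same sector are at a distance
at most that of one of them from `p`. -/
theorem exists_three_sectors {p x : Plane} (hx : x ≠ p) :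
    ∃ σ : Plane → Fin 3, ∀ y z, dist x p ^ 2 + dist y p ^ 2 ≤ dist x y ^ 2 →
      dist x p ^ 2 + dist z p ^ 2 ≤ dist x z ^ 2 → σ y = σ z →
      dist y z ^ 2 ≤ max (dist y p ^ 2) (dist z p ^ 2) := by
  have hpos : 0 < dist x p ^ 2 := by have := dist_pos.2 hx; positivity
  -- Coordinates of `y - p` along and across the direction from `x` to `p`, scaled by `dist x p`
  -- and, along it, also by `1 / √3`, which makes `V = U` and `V = -U` the two inner rays.
  let U : Plane → ℝ := fun y =>
    -((x 0 - p 0) * (y 0 - p 0) + (x 1 - p 1) * (y 1 - p 1)) / √3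
  let V : Plane → ℝ := fun y => (x 0 - p 0) * (y 1 - p 1) - (x 1 - p 1) * (y 0 - p 0)
  have h3 : √3 ^ 2 = 3 := Real.sq_sqrt (by norm_num)
  have h3' : 0 < √3 := by positivity
  have hUV : ∀ y z : Plane, 3 * (U y - U z) ^ 2 + (V y - V z) ^ 2 =
      dist x p ^ 2 * dist y z ^ 2 := by
    intro y z
    simp only [U, V, Plane.dist_sq_eq]
    rw [← sub_div, div_pow, h3]
    ring
  have hUp : U p = 0 := by simp [U]
  have hVp : V p = 0 := by simp [V]
  have hU : ∀ y, dist x p ^ 2 + dist y p ^ 2 ≤ dist x y ^ 2 → 0 ≤ U y := by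
    intro y hy
    simp only [Plane.dist_sq_eq] at hy
    exact div_nonneg (by linarith) h3'.le
  refine ⟨fun y => if U y ≤ V y then 0 else if V y ≤ -U y then 1 else 2, fun y z hy hz h => ?_⟩
  have hs : U y ≤ V y ∧ U z ≤ V z ∨ V y ≤ -U y ∧ V z ≤ -U z ∨
      (-U y ≤ V y ∧ V y ≤ U y) ∧ (-U z ≤ V z ∧ V z ≤ U z) := by
    dsimp only at h
    split_ifs at h with h1 h2 h3 h4 h5 h6 <;> simp_all [le_of_lt]
  have hyz := sq_sub_le_max_of_same_sector (hU y hy) (hU z hz) hs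
  have hyp := hUV y p
  have hzp := hUV z p
  rw [hUp, hVp, sub_zero, sub_zero] at hyp hzp
  rw [hUV, hyp, hzp, ← mul_max_of_nonneg _ _ hpos.le] at hyz
  exact le_of_mul_le_mul_left hyz hpos

open SimpleGraph in
/-- If the disks of all the edges which are deleted from a bottleneck tree contain the point `p`,
then at most four components are left.

Let `x C` be the point of the component `C` nearest to `p`, and `C₀` the component nearest to `p`.
The path from `x C` to `x D` leaves `C` along a deleted edge, which is at least as long as the
hypotenuse of a right triangle with legs `dist (x C) p` and `dist (x C₀) p`; so
`dist (x C) (x D)` is at least as long. Hence `x D`, for `D ≠ C₀`, lies in the half-plane opposite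
to `x C₀`, and any two of these points are seen from `p` under an angle of more than `π / 3`:
there is room for three of them only. -/
theorem card_connectedComponent_le_four {α : Type*} [Finite α] {f : α → Plane} {T F : SimpleGraph α}
    (hT : T.IsTree) (hmin : ∀ (x y : α) (w : T.Walk x y), w.IsPath →
      ∀ a b, s(a, b) ∈ w.edges → dist (f a) (f b) ^ 2 ≤ dist (f x) (f y) ^ 2)
    {p : Plane} (hp : ∀ a, f a ≠ p)
    (hF : ∀ a b, T.Adj a b → ¬ F.Adj a b → p ∈ diametralDisk (f a) (f b)) :
    Nat.card F.ConnectedComponent ≤ 4 := by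
  classical
  have := hT.connected.nonempty
  have hx : ∀ C : F.ConnectedComponent, ∃ a, F.connectedComponentMk a = C ∧
      ∀ b, F.connectedComponentMk b = C → dist (f a) p ≤ dist (f b) p := by
    intro C
    obtain ⟨a, ha, h⟩ := Set.exists_min_image C.supp (fun a => dist (f a) p) (Set.toFinite _)
      C.nonempty_supp
    exact ⟨a, ha, h⟩
  choose x hxC hxmin using hx
  obtain ⟨C₀, hC₀⟩ := Finite.exists_min (fun C => dist (f (x C)) p)
  have hx₀ : ∀ b, dist (f (x C₀)) p ≤ dist (f b) p := fun b => (hC₀ _).trans (hxmin _ b rfl)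
  have key : ∀ C D, C ≠ D →
      dist (f (x C)) p ^ 2 + dist (f (x C₀)) p ^ 2 ≤ dist (f (x C)) (f (x D)) ^ 2 := by
    intro C D hCD
    obtain ⟨w, hw⟩ := hT.connected.exists_isPath (x C) (x D)
    obtain ⟨d, hd, h1, h2⟩ := w.exists_boundary_dart C.supp (hxC C)
      (fun h => hCD (((hxC D).symm.trans h).symm))
    have hadj : ¬ F.Adj d.fst d.snd := fun h =>
      h2 ((ConnectedComponent.sound h.symm.reachable).trans h1)
    have h3 := mem_diametralDisk_iff.1 (hF _ _ d.adj hadj)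
    have h4 := hmin _ _ w hw d.fst d.snd (List.mem_map_of_mem hd)
    have h5 := pow_le_pow_left₀ dist_nonneg (hxmin C d.fst h1) 2
    have h6 := pow_le_pow_left₀ dist_nonneg (hx₀ d.snd) 2
    linarith
  have hpos : 0 < dist (f (x C₀)) p ^ 2 := by have := dist_pos.2 (hp (x C₀)); positivity
  have hobt : ∀ D, D ≠ C₀ →
      dist (f (x C₀)) p ^ 2 + dist (f (x D)) p ^ 2 ≤ dist (f (x C₀)) (f (x D)) ^ 2 := by
    intro D hD
    have := key D C₀ hD
    rwa [dist_comm (f (x C₀)) (f (x D)), add_comm]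
  obtain ⟨σ, hσ⟩ := exists_three_sectors (hp (x C₀))
  have hinj : Function.Injective (fun D : {D // D ≠ C₀} => σ (f (x D))) := by
    rintro ⟨C, hC⟩ ⟨D, hD⟩ h
    by_contra hne
    have hCD : C ≠ D := fun h => hne (Subtype.ext h)
    have h1 := key C D hCD
    have h2 := key D C hCD.symm
    rw [dist_comm (f (x D)) (f (x C))] at h2
    rcases le_max_iff.1 (hσ _ _ (hobt C hC) (hobt D hD) h) with h3 | h3 <;> linarith
  have h1 := Nat.card_le_card_of_injective _ hinj
  have h2 := Set.ncard_add_ncard_compl ({C₀} : Set F.ConnectedComponent)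
  have h3 : ({C₀}ᶜ : Set F.ConnectedComponent).ncard = Nat.card {D // D ≠ C₀} := rfl
  rw [Set.ncard_singleton] at h2
  rw [Nat.card_fin] at h1
  lia

open SimpleGraph in
/-- A graph on points outside of `S` that contains all the edges whose disk contains neither another
vertex nor a point of `S` has at most `1 + 3 * #S` components. -/
theorem card_connectedComponent_le_one_add_three_mul {α : Type*} [Finite α] {f : α → Plane}
    (hf : Function.Injective f) (S : Finset Plane) (hS : ∀ a, f a ∉ S) (K : SimpleGraph α)
    (hK : ∀ a b, a ≠ b → (∀ c, c ≠ a → c ≠ b → f c ∉ diametralDisk (f a) (f b)) →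
      (∀ p ∈ S, p ∉ diametralDisk (f a) (f b)) → K.Adj a b) :
    Nat.card K.ConnectedComponent ≤ 1 + 3 * S.card := by
  classical
  rcases isEmpty_or_nonempty α with hα | hα
  · have : IsEmpty K.ConnectedComponent := ⟨fun C => hα.elim C.out⟩
    simp
  obtain ⟨T, hT, hmin'⟩ := exists_isTree_forall_weight_le
    (Sym2.lift ⟨fun a b => dist (f a) (f b) ^ 2, fun a b =>
      congrArg (· ^ 2) (_root_.dist_comm _ _)⟩)
  have hmin : ∀ (x y : α) (w : T.Walk x y), w.IsPath →
      ∀ a b, s(a, b) ∈ w.edges → dist (f a) (f b) ^ 2 ≤ dist (f x) (f y) ^ 2 :=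
    fun x y w hw a b h => hmin' x y w hw _ h
  -- The disk of a tree edge `ab` contains no other vertex `c`: the path from `c` to one of `a`, `b`
  -- passes through the edge `ab`, but both are nearer to `c` than to each other.
  have hempty : ∀ a b, T.Adj a b → ∀ c, c ≠ a → c ≠ b → f c ∉ diametralDisk (f a) (f b) := by
    intro a b hab c hca hcb hc
    have hc := mem_diametralDisk_iff.1 hc
    have hac : 0 < dist (f a) (f c) ^ 2 := by
      have := dist_pos.2 (hf.ne hca.symm); positivity
    have hbc : 0 < dist (f b) (f c) ^ 2 := by
      have := dist_pos.2 (hf.ne hcb.symm); positivity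
    obtain ⟨w, hw⟩ := hT.connected.exists_isPath a c
    obtain ⟨w', hw'⟩ := hT.connected.exists_isPath b c
    by_cases h : s(a, b) ∈ w.edges
    · have := hmin _ _ w hw a b h
      linarith
    by_cases h' : s(a, b) ∈ w'.edges
    · have := hmin _ _ w' hw' a b h'
      linarith
    refine (isAcyclic_iff_forall_adj_isBridge.1 hT.isAcyclic hab) ?_
    exact (reachable_deleteEdges_iff_exists_walk.2 ⟨w, h⟩).trans
      (reachable_deleteEdges_iff_exists_walk.2 ⟨w', h'⟩).symm
  let B : Plane → Set (Sym2 α) := fun p =>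
    {e | e ∈ T.edgeSet ∧ ∃ a b, e = s(a, b) ∧ p ∈ diametralDisk (f a) (f b)}
  have hB : ∀ p ∈ S, (B p).ncard ≤ 3 := by
    intro p hp
    have h1 := hT.ncard_edgeSet_sdiff_add_one_le (deleteEdges_le (B p))
    have h2 : Nat.card (T.deleteEdges (B p)).ConnectedComponent ≤ 4 := by
      refine card_connectedComponent_le_four hT hmin (p := p)
        (fun a h => hS a (h ▸ hp)) fun a b hab h => ?_
      obtain ⟨-, a', b', heq, h'⟩ : s(a, b) ∈ B p := by
        by_contra h'
        exact h (deleteEdges_adj.2 ⟨hab, h'⟩)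
      rcases Sym2.eq_iff.1 heq with ⟨rfl, rfl⟩ | ⟨rfl, rfl⟩
      · exact h'
      · rwa [diametralDisk, midpoint_comm, _root_.dist_comm]
    have h3 : T.edgeSet \ (T.deleteEdges (B p)).edgeSet = B p := by
      rw [edgeSet_deleteEdges, sdiff_sdiff_right_self]
      exact Set.inter_eq_right.2 fun e he => he.1
    rw [h3] at h1
    lia
  refine (hT.connected.card_connectedComponent_le (F := K)).trans ?_
  have hsub : T.edgeSet \ K.edgeSet ⊆ ⋃ p ∈ S, B p := by
    rintro e ⟨heT, heK⟩
    induction e with | _ a b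
    by_contra h
    simp only [Set.mem_iUnion, not_exists] at h
    exact heK (hK a b (Adj.ne heT) (hempty a b heT)
      fun p hp hpd => h p hp ⟨heT, a, b, rfl, hpd⟩)
  have h4 := Set.ncard_le_ncard hsub (Set.toFinite _)
  have h5 : (⋃ p ∈ S, B p).ncard ≤ ∑ p ∈ S, (B p).ncard := Finset.set_ncard_biUnion_le S B
  have h6 := Finset.sum_le_card_nsmul S _ 3 hB
  rw [smul_eq_mul] at h6
  lia

/-! ### Matchings and odd components -/

namespace SimpleGraph

variable {V W : Type*}

theorem Iso.ncard_oddComponents_eq [Finite V] {G : SimpleGraph V} {G' : SimpleGraph W}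
    (φ : G ≃g G') : G.oddComponents.ncard = G'.oddComponents.ncard := by
  have h : ∀ C : G.ConnectedComponent,
      (φ.connectedComponentEquiv C).supp.ncard = C.supp.ncard := fun C =>
    (Nat.card_congr (ConnectedComponent.isoEquivSupp φ C)).symm
  rw [← Set.ncard_image_of_injective _ φ.connectedComponentEquiv.injective]
  congr 1
  ext D
  obtain ⟨C, rfl⟩ := φ.connectedComponentEquiv.surjective D
  rw [φ.connectedComponentEquiv.injective.mem_set_image]
  simp only [Set.mem_ofPred_eq, h]

/-- The join of `G` with the complete graph on `d` new vertices: two distinct vertices are adjacent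
unless both belong to `G` and are not adjacent there. -/
def joinComplete (G : SimpleGraph V) (d : ℕ) : SimpleGraph (V ⊕ Fin d) where
  Adj x y := x ≠ y ∧ ∀ a b, x = .inl a → y = .inl b → G.Adj a b
  symm := ⟨fun _ _ h => ⟨h.1.symm, fun a b ha hb => (h.2 b a hb ha).symm⟩⟩
  loopless := ⟨fun _ h => h.1 rfl⟩

theorem joinComplete_adj_inl {G : SimpleGraph V} {d : ℕ} {a b : V} :
    (G.joinComplete d).Adj (.inl a) (.inl b) ↔ G.Adj a b := by
  refine ⟨fun h => h.2 a b rfl rfl, fun h => ⟨fun h' => h.ne (Sum.inl_injective h'), ?_⟩⟩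
  rintro _ _ ⟨⟩ ⟨⟩
  exact h

/-- A matching covering all but `d` vertices of `G` is what is left of a perfect matching of the
join with the complete graph on `d` vertices. -/
theorem exists_isMatching_of_joinComplete [Finite V] {G : SimpleGraph V} {d : ℕ}
    {M : (G.joinComplete d).Subgraph} (hM : M.IsPerfectMatching) :
    ∃ N : G.Subgraph, N.IsMatching ∧ Nat.card V ≤ 2 * N.edgeSet.ncard + d := by
  rw [Subgraph.isPerfectMatching_iff] at hM
  let N : G.Subgraph :=
    { verts := {a | ∃ b, M.Adj (.inl a) (.inl b)}
      Adj := fun a b => M.Adj (.inl a) (.inl b)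
      adj_sub := fun h => joinComplete_adj_inl.1 h.adj_sub
      edge_vert := fun h => ⟨_, h⟩
      symm := ⟨fun _ _ h => h.symm⟩ }
  have hN : N.IsMatching := by
    rintro a ⟨b, hb⟩
    exact ⟨b, hb, fun c hc => Sum.inl_injective ((hM (.inl a)).unique hc hb)⟩
  refine ⟨N, hN, ?_⟩
  have h1 : N.verts.ncard ≤ 2 * N.edgeSet.ncard := by
    classical
    rw [hN.verts_eq_biUnion_edgeSet]
    have hfin : N.edgeSet.Finite := Set.toFinite _
    have h2 : (⋃ e ∈ N.edgeSet, (e : Set V)) = ⋃ e ∈ hfin.toFinset, (e : Set V) := by simp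
    rw [h2]
    refine (Finset.set_ncard_biUnion_le _ _).trans ?_
    refine (Finset.sum_le_card_nsmul _ _ 2 fun e _ => ?_).trans_eq ?_
    · induction e with | _ a b
      rw [Sym2.coe_mk]
      exact (Set.ncard_insert_le a {b}).trans (by rw [Set.ncard_singleton])
    · rw [smul_eq_mul, mul_comm, Set.ncard_eq_toFinset_card _ hfin]
  have h2 : (N.vertsᶜ).ncard ≤ d := by
    -- The vertices missed by `N` have distinct partners among the `d` new vertices.
    have hex : ∀ a : ↥(N.vertsᶜ), ∃ j : Fin d, M.Adj (.inl a) (.inr j) := by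
      rintro ⟨a, ha⟩
      obtain ⟨b | j, hb, -⟩ := hM (.inl a)
      · exact (ha ⟨b, hb⟩).elim
      · exact ⟨j, hb⟩
    choose g hg using hex
    have hinj : Function.Injective g := by
      intro a b hab
      have h3 := hg b
      rw [← hab] at h3
      exact Subtype.ext (Sum.inl_injective ((hM (.inr (g a))).unique (hg a).symm h3.symm))
    have := Nat.card_le_card_of_injective g hinj
    rwa [Nat.card_fin] at this
  have h3 := Set.ncard_add_ncard_compl N.verts
  lia

/-- The deficiency version of Tutte's theorem: if `d` has the parity of the number of vertices and
no set `S` leaves more than `#S + d` odd components, then some matching misses at most `d`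
vertices. -/
theorem exists_isMatching_of_oddComponents_le [Finite V] {G : SimpleGraph V} {d : ℕ}
    (hd : Even (Nat.card V + d))
    (h : ∀ S : Set V, ((⊤ : G.Subgraph).deleteVerts S).coe.oddComponents.ncard ≤ S.ncard + d) :
    ∃ N : G.Subgraph, N.IsMatching ∧ Nat.card V ≤ 2 * N.edgeSet.ncard + d := by
  suffices ∃ M : (G.joinComplete d).Subgraph, M.IsPerfectMatching by
    obtain ⟨M, hM⟩ := this
    exact exists_isMatching_of_joinComplete hM
  rw [tutte]
  intro U
  rw [IsTutteViolator, not_lt]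
  by_cases hU : ∀ j, Sum.inr j ∈ U
  · -- All new vertices are deleted: what is left is `G` without the old vertices in `U`.
    let S : Set V := Sum.inl ⁻¹' U
    have hcard : U.ncard = S.ncard + d := by
      have h1 : U = Sum.inl '' S ∪ Set.range Sum.inr := by
        ext (a | j) <;> simp [S, hU]
      have h2 : Disjoint (Sum.inl '' S) (Set.range (Sum.inr : Fin d → V ⊕ Fin d)) := by
        rw [Set.disjoint_left]
        rintro _ ⟨a, -, rfl⟩ ⟨j, hj⟩
        exact Sum.inr_ne_inl hj
      rw [h1, Set.ncard_union_eq h2, Set.ncard_image_of_injective _ Sum.inl_injective,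
        ← Set.image_univ, Set.ncard_image_of_injective _ Sum.inr_injective, Set.ncard_univ,
        Nat.card_fin]
    let g : ((⊤ : G.Subgraph).deleteVerts S).verts →
        ((⊤ : (G.joinComplete d).Subgraph).deleteVerts U).verts := fun a => ⟨.inl a, by
      have := a.2; simpa [S] using this⟩
    have hg : Function.Bijective g := by
      constructor
      · intro a b hab
        exact Subtype.ext (Sum.inl_injective (congrArg Subtype.val hab))
      · rintro ⟨a | j, hx⟩
        · exact ⟨⟨a, by simpa [S] using hx⟩, rfl⟩
        · simp [hU] at hx
    let φ : ((⊤ : G.Subgraph).deleteVerts S).coe ≃g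
        ((⊤ : (G.joinComplete d).Subgraph).deleteVerts U).coe :=
      { toEquiv := Equiv.ofBijective g hg
        map_rel_iff' := by
          rintro ⟨a, ha⟩ ⟨b, hb⟩
          simp [g, joinComplete_adj_inl, S] at ha hb ⊢ }
    rw [← φ.ncard_oddComponents_eq, hcard]
    exact h S
  · -- A remaining new vertex is joined to all the others, so at most one component is left.
    push Not at hU
    obtain ⟨j, hj⟩ := hU
    set H := ((⊤ : (G.joinComplete d).Subgraph).deleteVerts U).coe with hH
    have hreach : ∀ x, H.Reachable x ⟨.inr j, by simpa using hj⟩ := by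
      rintro ⟨x, hx⟩
      by_cases hxj : x = .inr j
      · subst hxj; rfl
      · have hx' : x ∉ U := by simpa using hx
        refine Adj.reachable ?_
        have hadj : (G.joinComplete d).Adj x (.inr j) :=
          ⟨hxj, fun a b _ hb => (Sum.inr_ne_inl hb).elim⟩
        simpa [hH, hj, hx'] using hadj
    have hone : Subsingleton H.ConnectedComponent := by
      refine ⟨fun C D => ?_⟩
      induction C using ConnectedComponent.ind with | _ a
      induction D using ConnectedComponent.ind with | _ b
      exact ConnectedComponent.sound ((hreach a).trans (hreach b).symm)
    have hle : H.oddComponents.ncard ≤ 1 := Set.ncard_le_one_of_subsingleton _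
    rcases Set.eq_empty_or_nonempty U with rfl | hne
    · have hpar := H.odd_ncard_oddComponents
      have hcard : Nat.card ((⊤ : (G.joinComplete d).Subgraph).deleteVerts ∅).verts =
          Nat.card V + d := by
        rw [Subgraph.deleteVerts_empty, Subgraph.verts_top, Nat.card_coe_set_eq, Set.ncard_univ,
          Nat.card_sum, Nat.card_fin]
      rw [hcard, ← Nat.not_even_iff_odd, ← Nat.not_even_iff_odd, not_iff_not] at hpar
      have := hpar.2 hd
      rw [Set.ncard_empty]
      rcases this with ⟨r, hr⟩
      lia
    · have := (Set.ncard_pos (Set.toFinite U)).2 hne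
      lia

/-- A graph in which the removal of any `s` vertices leaves at most `1 + 3 * s` components has a
matching with at least `(n - 1) / 4` edges, where `n` is the number of vertices. -/
theorem exists_isMatching_of_card_connectedComponent_le [Finite V] {G : SimpleGraph V}
    (h : ∀ S : Set V, Nat.card ((⊤ : G.Subgraph).deleteVerts S).coe.ConnectedComponent ≤
      1 + 3 * S.ncard) :
    ∃ N : G.Subgraph, N.IsMatching ∧ Nat.card V ≤ 4 * N.edgeSet.ncard + 1 := by
  -- The number `d` of missed vertices is the largest one up to `(n + 1) / 2` of the right parity.
  obtain ⟨d, hd, hd1, hd2⟩ : ∃ d, Even (Nat.card V + d) ∧ Nat.card V ≤ 2 * d + 2 ∧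
      2 * d ≤ Nat.card V + 1 := by
    generalize Nat.card V = n
    rcases Nat.even_or_odd (n + (n + 1) / 2) with hn | hn
    · exact ⟨(n + 1) / 2, hn, by lia, by lia⟩
    · refine ⟨(n + 1) / 2 - 1, ?_, by lia, by lia⟩
      rw [Nat.odd_iff] at hn
      rw [Nat.even_iff]
      lia
  have hodd : ∀ S : Set V,
      ((⊤ : G.Subgraph).deleteVerts S).coe.oddComponents.ncard ≤ S.ncard + d := by
    intro S
    set H := ((⊤ : G.Subgraph).deleteVerts S).coe
    have hn : Nat.card ((⊤ : G.Subgraph).deleteVerts S).verts + S.ncard = Nat.card V := by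
      rw [Subgraph.deleteVerts_verts, Subgraph.verts_top, Nat.card_coe_set_eq,
        ← Set.compl_eq_univ_sdiff, add_comm]
      exact Set.ncard_add_ncard_compl S
    have h1 : H.oddComponents.ncard ≤ 1 + 3 * S.ncard := (Set.ncard_le_card _).trans (h S)
    have h2 : H.oddComponents.ncard ≤ Nat.card ((⊤ : G.Subgraph).deleteVerts S).verts :=
      (Set.ncard_le_card _).trans
        (Nat.card_le_card_of_surjective H.connectedComponentMk Quot.mk_surjective)
    have h3 := H.odd_ncard_oddComponents
    -- By parity an odd component count above `s + d` is at least `s + d + 2`, which exceeds the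
    -- average of the two bounds `h1` and `h2`.
    rw [Nat.odd_iff, Nat.odd_iff] at h3
    rw [Nat.even_iff] at hd
    lia
  obtain ⟨N, hN, hcard⟩ := exists_isMatching_of_oddComponents_le hd hodd
  exact ⟨N, hN, by lia⟩

end SimpleGraph

/-! ### Large matchings in Gabriel graphs -/

theorem gabrielGraph_zero_adj_iff {P : Finset Plane} {p q : P} :
    (gabrielGraph 0 P).Adj p q ↔ p ≠ q ∧
      ∀ r : P, r ≠ p → r ≠ q → (r : Plane) ∉ diametralDisk (p : Plane) (q : Plane) := by
  have hfin : (((P : Set Plane) \ {(p : Plane), (q : Plane)}) ∩ diametralDisk p q).Finite :=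
    P.finite_toSet.subset fun r hr => hr.1.1
  change p ≠ q ∧ _ ≤ 0 ↔ _
  rw [Nat.le_zero, Set.ncard_eq_zero hfin, Set.eq_empty_iff_forall_notMem]
  refine and_congr_right fun _ => ⟨fun h r hp hq hr => h r ⟨⟨r.2, ?_⟩, hr⟩, ?_⟩
  · rintro (h | h)
    · exact hp (Subtype.ext h)
    · exact hq (Subtype.ext h)
  · rintro h r ⟨⟨hrP, hne⟩, hr⟩
    simp only [Set.mem_insert_iff, Set.mem_singleton_iff, not_or] at hne
    exact h ⟨r, hrP⟩ (fun h => hne.1 (congrArg Subtype.val h))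
      (fun h => hne.2 (congrArg Subtype.val h)) hr

open SimpleGraph in
theorem exists_isMatching_gabrielGraph (P : Finset Plane) : ∃ M : (gabrielGraph 0 P).Subgraph,
    M.IsMatching ∧ ((P.card : ℝ) - 1) / 4 ≤ (M.edgeSet.ncard : ℝ) := by
  classical
  obtain ⟨N, hN, hcard⟩ :=
    exists_isMatching_of_card_connectedComponent_le (G := gabrielGraph 0 P) fun S => by
      have hS : (S.toFinite.toFinset.map (Function.Embedding.subtype (· ∈ P))).card = S.ncard := by
        rw [Finset.card_map, Set.ncard_eq_toFinset_card S]
      rw [← hS]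
      refine card_connectedComponent_le_one_add_three_mul
        (α := ((⊤ : (gabrielGraph 0 P).Subgraph).deleteVerts S).verts) (f := fun a => a.1.1)
        (fun a b h => Subtype.ext (Subtype.ext h)) _ ?_ _ ?_
      · rintro ⟨a, ha⟩ h
        simp at ha h
        exact ha h
      · rintro ⟨a, ha⟩ ⟨b, hb⟩ hab h1 h2
        have ha' : a ∉ S := by simpa using ha
        have hb' : b ∉ S := by simpa using hb
        have : (gabrielGraph 0 P).Adj a b := by
          refine gabrielGraph_zero_adj_iff.2 ⟨fun h => hab (Subtype.ext h), ?_⟩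
          intro r hra hrb
          by_cases hr : r ∈ S
          · refine h2 r ?_
            simpa using hr
          · exact h1 ⟨r, by simpa using hr⟩ (fun h => hra (congrArg Subtype.val h))
              (fun h => hrb (congrArg Subtype.val h))
        simpa [ha', hb'] using this
  refine ⟨N, hN, ?_⟩
  rw [Nat.card_eq_fintype_card, Fintype.card_coe] at hcard
  have : (P.card : ℝ) ≤ 4 * N.edgeSet.ncard + 1 := by exact_mod_cast hcard
  linarith

/-! ### Matchings under isomorphisms and vertex covers -/

namespace SimpleGraph

variable {V W : Type*}

theorem Iso.matchingSizes_subset {G : SimpleGraph V} {G' : SimpleGraph W} (φ : G ≃g G') :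
    matchingSizes G ⊆ matchingSizes G' := by
  rintro m ⟨M, hM, rfl⟩
  refine ⟨M.map φ.toHom, hM.map φ.toHom φ.injective, ?_⟩
  rw [Subgraph.edgeSet_map]
  exact Set.ncard_image_of_injective _ (Sym2.map.injective φ.injective)

theorem Iso.maxDegree_le [Fintype V] [Fintype W] {G : SimpleGraph V} {G' : SimpleGraph W}
    [DecidableRel G.Adj] [DecidableRel G'.Adj] (φ : G ≃g G') : G.maxDegree ≤ G'.maxDegree := by
  refine G.maxDegree_le_of_forall_degree_le _ fun v => ?_
  rw [← card_neighborSet_eq_degree, Fintype.card_congr (φ.mapNeighborSet v),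
    card_neighborSet_eq_degree]
  exact G'.degree_le_maxDegree _

/-- A matching has at most one edge at each vertex of a vertex cover. -/
theorem Subgraph.IsMatching.ncard_edgeSet_le {G : SimpleGraph V} {M : G.Subgraph}
    (hM : M.IsMatching) (C : Finset V) (hC : ∀ a b, G.Adj a b → a ∈ C ∨ b ∈ C) :
    M.edgeSet.ncard ≤ C.card := by
  classical
  have hpartner : ∀ a, ∃ b, ∀ c, M.Adj a c → c = b := by
    intro a
    by_cases ha : a ∈ M.verts
    · obtain ⟨b, -, hb⟩ := hM ha
      exact ⟨b, hb⟩
    · exact ⟨a, fun c hc => (ha (M.edge_vert hc)).elim⟩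
  choose g hg using hpartner
  have hsub : M.edgeSet ⊆ (fun a => s(a, g a)) '' (C : Set V) := by
    intro e he
    induction e with | _ a b
    have he : M.Adj a b := he
    rcases hC a b he.adj_sub with h | h
    · exact ⟨a, h, by simp only [← hg a b he]⟩
    · exact ⟨b, h, by simp only [← hg b a he.symm, Sym2.eq_swap]⟩
  refine (Set.ncard_le_ncard hsub (C.finite_toSet.image _)).trans ?_
  exact (Set.ncard_image_le C.finite_toSet).trans_eq (Set.ncard_coe_finset C)

end SimpleGraph

/-! ### The comb -/

/-- The 17 points of a comb: the points `(k, 0)` with `-1 ≤ k ≤ 7`, in this order, followed by the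
points `(0, 1)`, `(0, -1)`, `(2, 1)`, `(2, -1)`, `(4, 1)`, `(4, -1)`, `(6, 1)`, `(6, -1)`. -/
def combCoord (i : Fin 17) : ℤ × ℤ :=
  if i.val < 9 then ((i.val : ℤ) - 1, 0)
  else (2 * ((i.val - 9) / 2 : ℕ), 1 - 2 * ((i.val - 9) % 2 : ℕ))

/-- The points `combCoord` in the Euclidean plane. -/
noncomputable def combPoint (i : Fin 17) : Plane :=
  !₂[((combCoord i).1 : ℝ), ((combCoord i).2 : ℝ)]

theorem combCoord_injective : Function.Injective combCoord := by decide

theorem combPoint_injective : Function.Injective combPoint := by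
  intro i j h
  have h0 := congrArg (fun p : Plane => p 0) h
  have h1 := congrArg (fun p : Plane => p 1) h
  simp [combPoint] at h0 h1
  exact combCoord_injective (Prod.ext h0 h1)

/-- The Gabriel graph of the comb, in terms of the integer coordinates: the point `k` lies outside
of the closed disk with diameter `ij` if and only if it sees `i` and `j` under an acute angle, which
makes adjacency decidable. -/
def combGraph : SimpleGraph (Fin 17) where
  Adj i j := i ≠ j ∧ ∀ k, k ≠ i → k ≠ j →
    0 < ((combCoord i).1 - (combCoord k).1) * ((combCoord j).1 - (combCoord k).1) +
      ((combCoord i).2 - (combCoord k).2) * ((combCoord j).2 - (combCoord k).2)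
  symm := ⟨fun i j h => ⟨h.1.symm, fun k hi hj => by
    have := h.2 k hj hi
    linarith⟩⟩
  loopless := ⟨fun _ h => h.1 rfl⟩

instance : DecidableRel combGraph.Adj := fun i j =>
  inferInstanceAs (Decidable (i ≠ j ∧ ∀ k, k ≠ i → k ≠ j →
    0 < ((combCoord i).1 - (combCoord k).1) * ((combCoord j).1 - (combCoord k).1) +
      ((combCoord i).2 - (combCoord k).2) * ((combCoord j).2 - (combCoord k).2)))

/-- The parent of each vertex in the comb graph, rooted at the end `0` of the spine. The value at the
root is irrelevant. -/
def combParent (i : Fin 17) : Fin 17 :=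
  if i.val < 9 then i - 1 else Fin.ofNat 17 (1 + 2 * ((i.val - 9) / 2))

set_option maxRecDepth 100000 in
theorem combGraph_adj_iff : ∀ i j, combGraph.Adj i j ↔
    i ≠ 0 ∧ j = combParent i ∨ j ≠ 0 ∧ i = combParent j := by
  decide +kernel

/-- Every vertex other than the root has a smaller parent, so it is connected to the root. -/
theorem combGraph_connected : combGraph.Connected := by
  have h : ∀ n (i : Fin 17), i.val = n → combGraph.Reachable i 0 := by
    intro n
    induction n using Nat.strong_induction_on with | _ n ih
    intro i hi
    by_cases h0 : i = 0
    · rw [h0]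
    · have hlt : ∀ i : Fin 17, i ≠ 0 → (combParent i).val < i.val := by decide
      have hadj : combGraph.Adj i (combParent i) := (combGraph_adj_iff _ _).2 (Or.inl ⟨h0, rfl⟩)
      exact hadj.reachable.trans (ih _ (hi ▸ hlt i h0) _ rfl)
  exact ⟨fun i j => (h _ i rfl).trans (h _ j rfl).symm⟩

set_option maxRecDepth 100000 in
theorem combGraph_degree_sum : ∑ i, combGraph.degree i = 32 := by
  decide +kernel

theorem combGraph_isTree : combGraph.IsTree := by
  refine SimpleGraph.isTree_iff_connected_and_card.2 ⟨combGraph_connected, ?_⟩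
  have h := combGraph.sum_degrees_eq_twice_card_edges
  rw [combGraph_degree_sum] at h
  rw [Nat.card_eq_fintype_card, ← SimpleGraph.edgeFinset_card, Nat.card_fin]
  lia

set_option maxRecDepth 100000 in
theorem combGraph_maxDegree : combGraph.maxDegree = 4 := by
  have h : (∀ i, combGraph.degree i ≤ 4) ∧ combGraph.degree 1 = 4 := by decide +kernel
  exact le_antisymm (combGraph.maxDegree_le_of_forall_degree_le 4 h.1)
    (h.2 ▸ combGraph.degree_le_maxDegree 1)

/-- The matching of the comb graph that joins each of the vertices `1`, `3`, `5`, `7` to the point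
above it. -/
def combMatching : combGraph.Subgraph where
  verts := {i | i ∈ ({1, 3, 5, 7, 9, 11, 13, 15} : Finset (Fin 17))}
  Adj i j := i ∈ ({1, 3, 5, 7} : Finset (Fin 17)) ∧ j = i + 8 ∨
    j ∈ ({1, 3, 5, 7} : Finset (Fin 17)) ∧ i = j + 8
  adj_sub := by
    intro i j
    rw [combGraph_adj_iff]
    revert i j
    decide
  edge_vert := by
    intro i j
    rw [Set.mem_ofPred_eq]
    revert i j
    decide
  symm := ⟨fun _ _ h => h.symm⟩

theorem combMatching_isMatching : combMatching.IsMatching := by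
  have h : ∀ i ∈ ({1, 3, 5, 7, 9, 11, 13, 15} : Finset (Fin 17)),
      ∃ j, (i ∈ ({1, 3, 5, 7} : Finset (Fin 17)) ∧ j = i + 8 ∨
        j ∈ ({1, 3, 5, 7} : Finset (Fin 17)) ∧ i = j + 8) ∧
      ∀ k, (i ∈ ({1, 3, 5, 7} : Finset (Fin 17)) ∧ k = i + 8 ∨
        k ∈ ({1, 3, 5, 7} : Finset (Fin 17)) ∧ i = k + 8) → k = j := by decide
  exact fun i hi => h i hi

theorem ncard_edgeSet_combMatching : combMatching.edgeSet.ncard = 4 := by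
  have h : combMatching.edgeSet =
      (({1, 3, 5, 7} : Finset (Fin 17)).image fun i => s(i, i + 8) : Finset (Sym2 (Fin 17))) := by
    ext e
    induction e with | _ i j
    change (i ∈ ({1, 3, 5, 7} : Finset (Fin 17)) ∧ j = i + 8 ∨
      j ∈ ({1, 3, 5, 7} : Finset (Fin 17)) ∧ i = j + 8) ↔ _
    rw [Finset.mem_coe]
    revert i j
    decide
  rw [h, Set.ncard_coe_finset]
  decide

theorem combGraph_isGreatest_matchingSizes : IsGreatest (matchingSizes combGraph) 4 := by
  refine ⟨⟨_, combMatching_isMatching, ncard_edgeSet_combMatching⟩, ?_⟩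
  rintro _ ⟨M, hM, rfl⟩
  refine hM.ncard_edgeSet_le {1, 3, 5, 7} ?_
  simp only [combGraph_adj_iff]
  decide

/-- The points of the comb, as a finite set in the plane. -/
noncomputable def comb : Finset Plane :=
  Finset.univ.map ⟨combPoint, combPoint_injective⟩

theorem combPoint_mem_diametralDisk_iff {i j k : Fin 17} :
    combPoint k ∈ diametralDisk (combPoint i) (combPoint j) ↔
      ((combCoord i).1 - (combCoord k).1) * ((combCoord j).1 - (combCoord k).1) +
        ((combCoord i).2 - (combCoord k).2) * ((combCoord j).2 - (combCoord k).2) ≤ 0 := by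
  rw [mem_diametralDisk_iff]
  simp only [Plane.dist_sq_eq, combPoint]
  rw [← Int.cast_le (R := ℝ)]
  push_cast
  constructor <;> intro h <;> linarith

/-- `combGraph` is the Gabriel graph of the comb. -/
noncomputable def combGraphIso : combGraph ≃g gabrielGraph 0 comb where
  toEquiv := Equiv.ofBijective
    (fun i => ⟨combPoint i, Finset.mem_map_of_mem ⟨combPoint, combPoint_injective⟩
      (Finset.mem_univ i)⟩)
    ⟨fun i j h => combPoint_injective (congrArg Subtype.val h), by
      rintro ⟨x, hx⟩
      obtain ⟨i, -, rfl⟩ := Finset.mem_map.1 hx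
      exact ⟨i, rfl⟩⟩
  map_rel_iff' := by
    intro i j
    rw [gabrielGraph_zero_adj_iff]
    constructor
    · rintro ⟨hne, h⟩
      refine ⟨fun hij => hne (by rw [hij]), fun k hki hkj => ?_⟩
      rw [← not_le, ← combPoint_mem_diametralDisk_iff]
      exact h ⟨combPoint k, Finset.mem_map_of_mem ⟨combPoint, combPoint_injective⟩
        (Finset.mem_univ k)⟩ (fun h => hki (combPoint_injective (congrArg Subtype.val h)))
        (fun h => hkj (combPoint_injective (congrArg Subtype.val h)))
    · rintro ⟨hne, h⟩
      refine ⟨fun hij => hne (combPoint_injective (congrArg Subtype.val hij)), ?_⟩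
      rintro ⟨x, hx⟩ hxi hxj
      obtain ⟨k, -, rfl⟩ := Finset.mem_map.1 hx
      have := h k (fun hk => hxi (by subst hk; rfl)) (fun hk => hxj (by subst hk; rfl))
      rw [← not_le, ← combPoint_mem_diametralDisk_iff] at this
      exact this

theorem mainTheorem6 :
    (∀ P : Finset Plane, ∃ M : (gabrielGraph 0 P).Subgraph,
      M.IsMatching ∧ ((P.card : ℝ) - 1) / 4 ≤ (M.edgeSet.ncard : ℝ)) ∧
    (∃ P : Finset Plane, P.card = 17 ∧
      (gabrielGraph 0 P).IsTree ∧
      (gabrielGraph 0 P).maxDegree = 4 ∧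
      IsGreatest (matchingSizes (gabrielGraph 0 P)) 4) := by
  refine ⟨exists_isMatching_gabrielGraph, comb, ?_, ?_, ?_, ?_⟩
  · rw [comb, Finset.card_map, Finset.card_univ, Fintype.card_fin]
  · exact combGraphIso.isTree_iff.1 combGraph_isTree
  · exact combGraph_maxDegree ▸ le_antisymm combGraphIso.symm.maxDegree_le combGraphIso.maxDegree_le
  · rw [combGraphIso.matchingSizes_subset.antisymm' combGraphIso.symm.matchingSizes_subset]
    exact combGraph_isGreatest_matchingSizes
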